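/- Consider a network on a finite node set $V$ with network matrix $G=G^0+G^\Delta\in\mathbb C^{V\times V}$ at a fixed frequency, where an edge $j\to i$ carries the entry $G_{ij}$. The edges are partitioned into a set $E^0$ of known edges, whose entries are collected in $G^0$, and a set $E^\Delta$ of unknown edges, whose entries are collected in $G^\Delta$. Let $\mathcal B,\mathcal C\subseteq V$ be the sets of excited and of measured nodes, $n_B=|\mathcal B|$, $n_C=|\mathcal C|$, and let $B\in\{0,1\}^{V\times \mathcal B}$, $C\in\{0,1\}^{\mathcal C\times V}$ be the corresponding selection matrices. Write $T(G)=(I-G)^{-1}$. "Almost all" means: all parameter values except possibly those in the zero set of some nonzero polynomial. For given known entries $G^0$, the network is *generically decoupled-identifiable* if for almost all pairs $(G,G')$ of matrices that have the known entries $G^0$, arbitrary entries on $E^\Delta$ and zeros elsewhere, $I-G$ and $I-G'$ are invertible and, for every $\Delta\in\mathbb C^{V\times V}$ supported on $E^\Delta$, $C\,T(G)\,\Delta\,T(G')\,B=0$ implies $\Delta=0$. Assume $|E^\Delta|=n_Bn_C$. Consider the following conditions on an assignation $\sigma=(\sigma_B,\sigma_C):E^\Delta\to\mathcal B\times\mathcal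 C$ (not necessarily bijective), where paths are directed, use known and unknown edges, may have length zero and may repeat nodes: (a) each excitation $b\in\mathcal B$ is assigned exactly $n_C$ unknown edges: $|\sigma_B^{-1}(b)|=n_C$; (b) each measurement $c\in\mathcal C$ is assigned exactly $n_B$ unknown edges: $|\sigma_C^{-1}(c)|=n_B$; (c) $\sigma$ is connected: for each $\alpha\in E^\Delta$ there is a path from $\sigma_B(\alpha)$ to $\sigma_C(\alpha)$ that includes the edge $\alpha$; (d) for each $b\in\mathcal B$ there are $n_C$ vertex-disjoint paths from end nodes of edges in $\sigma_B^{-1}(b)$ to nodes of $\mathcal C$; (e) for each $c\in\mathcal C$ there are $n_B$ vertex-disjoint paths from nodes of $\mathcal B$ to start nodes of edges in $\sigma_C^{-1}(c)$. Then: 1. For every choice of the known entries $G^0$, if the network is generically decoupled-identifiable, then there is at least one assignation $\sigma$ satisfying (a)–(e). 2. If there is exactly one assignation $\sigma$ satisfying (a)–(e), then for almost all choices of the known entries $G^0$ the network is generically decoupled-identifiable. -/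

import Mathlib

/-- A networked system on the nodes `V`. An edge `(j, i)` is directed from `j` to `i` and carries
the entry `G i j` of the network matrix (node signals obey `w = G w + B r`, `y = C w`). -/
structure Network (V : Type*) where
  /-- edges whose transfer function is known -/
  known : Finset (V × V)
  /-- edges whose transfer function is unknown -/
  unknown : Finset (V × V)
  /-- excited nodes -/
  excited : Finset V
  /-- measured nodes -/
  measured : Finset V
  /-- no edge is both known and unknown -/
  disjoint : Disjoint known unknown

/-- `AlmostAll P`: `P x` holds for all parameter vectors `x` except possibly those lying on a
lower-dimensional set, i.e. in the zero set of a nonzero polynomial. -/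
def AlmostAll {ι : Type*} (P : (ι → ℂ) → Prop) : Prop :=
  ∃ p : MvPolynomial ι ℂ, p ≠ 0 ∧ ∀ x : ι → ℂ, MvPolynomial.eval x p ≠ 0 → P x

/-- A directed path from `u` to `v`: a nonempty list of successively adjacent nodes, with first node
`u` and last node `v`. Paths of length zero (`u = v`) are allowed, and so are repeated nodes. -/
structure IsDipath {V : Type*} (D : Digraph V) (u v : V) (l : List V) : Prop where
  chain : l.IsChain D.Adj
  head : l.head? = some u
  last : l.getLast? = some v

/-- There is a path from `u` to `v` in `D` that includes the edge `e`. -/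
def ConnectedThrough {V : Type*} (D : Digraph V) (u : V) (e : V × V) (v : V) : Prop :=
  ∃ l₁ l₂ : List V, l₁.getLast? = some e.1 ∧ l₂.head? = some e.2 ∧ IsDipath D u v (l₁ ++ l₂)

/-- There are `k` vertex-disjoint paths in `D` from nodes of `S` to nodes of `T`: no two of them
contain the same vertex. -/
def HasVertexDisjointPaths {V : Type*} (D : Digraph V) (k : ℕ) (S T : Set V) : Prop :=
  ∃ p : Fin k → List V, (∀ m, ∃ u ∈ S, ∃ v ∈ T, IsDipath D u v (p m)) ∧
    Pairwise fun m m' => List.Disjoint (p m) (p m')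

namespace Network

variable {V : Type*}

/-- The directed graph of the network, with all known and unknown edges. -/
def graph (N : Network V) : Digraph V where
  Adj j i := (j, i) ∈ N.known ∨ (j, i) ∈ N.unknown

/-- The matrix with entry `x (j, i)` at position `(i, j)` for the edges `(j, i)` of `E`, and zero
elsewhere. -/
def edgeMatrix [DecidableEq V] (E : Finset (V × V)) (x : E → ℂ) : Matrix V V ℂ :=
  Matrix.of fun i j => if h : (j, i) ∈ E then x ⟨(j, i), h⟩ else 0

/-- The network matrix `G = G⁰ + G^Δ`, with known entries `g` and unknown entries `x`. -/
def networkMatrix [DecidableEq V] (N : Network V) (g : N.known → ℂ) (x : N.unknown → ℂ) :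
    Matrix V V ℂ :=
  edgeMatrix N.known g + edgeMatrix N.unknown x

/-- The excitation matrix `B`: each column selects one excited node. -/
def excitationMatrix [DecidableEq V] (N : Network V) : Matrix V N.excited ℂ :=
  Matrix.of fun i b => if i = (b : V) then 1 else 0

/-- The measurement matrix `C`: each row selects one measured node. -/
def measurementMatrix [DecidableEq V] (N : Network V) : Matrix N.measured V ℂ :=
  Matrix.of fun c i => if i = (c : V) then 1 else 0

/-- The network is well-posed at `G`: the matrix `I - G` is invertible. -/
def WellPosed [Fintype V] [DecidableEq V] (G : Matrix V V ℂ) : Prop :=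
  IsUnit (1 - G)

/-- The transfer matrix `T(G) = (I - G)⁻¹`. -/
noncomputable def transfer [Fintype V] [DecidableEq V] (G : Matrix V V ℂ) : Matrix V V ℂ :=
  (1 - G)⁻¹

/-- Decoupled identifiability at `(G, G')`: for all `Δ` with the zero entries of `G^Δ`,
`C T(G) Δ T(G') B = 0` implies `Δ = 0`. -/
def DecoupledIdentifiableAt [Fintype V] [DecidableEq V] (N : Network V)
    (G G' : Matrix V V ℂ) : Prop :=
  ∀ Δ : Matrix V V ℂ, (∀ i j, (j, i) ∉ N.unknown → Δ i j = 0) →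
    N.measurementMatrix * transfer G * Δ * transfer G' * N.excitationMatrix = 0 → Δ = 0

/-- Generic decoupled identifiability, for known entries `g`: for almost all pairs `(G, G')` with
these known entries, the network is well-posed and decoupled-identifiable at `(G, G')`. -/
def GenericallyDecoupledIdentifiable [Fintype V] [DecidableEq V] (N : Network V)
    (g : N.known → ℂ) : Prop :=
  AlmostAll fun z : N.unknown ⊕ N.unknown → ℂ =>
    let G := N.networkMatrix g fun e => z (Sum.inl e)
    let G' := N.networkMatrix g fun e => z (Sum.inr e)
    WellPosed G ∧ WellPosed G' ∧ N.DecoupledIdentifiableAt G G'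

/-- The path conditions on an assignation `σ = (σ_B, σ_C)` of the unknown edges to pairs
(excitation, measurement). Paths from an edge start at its end node, and paths to an edge stop at
its start node. -/
structure PathConditions [DecidableEq V] (N : Network V)
    (σ : N.unknown → N.excited × N.measured) : Prop where
  card_excitation : ∀ b : N.excited, Fintype.card {α // (σ α).1 = b} = N.measured.card
  card_measurement : ∀ c : N.measured, Fintype.card {α // (σ α).2 = c} = N.excited.card
  connected : ∀ α : N.unknown, ConnectedThrough N.graph (σ α).1 α (σ α).2
  paths_to_measured : ∀ b : N.excited, HasVertexDisjointPaths N.graph N.measured.card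
    {v | ∃ α : N.unknown, (σ α).1 = b ∧ α.1.2 = v} {v | v ∈ N.measured}
  paths_from_excited : ∀ c : N.measured, HasVertexDisjointPaths N.graph N.excited.card
    {v | v ∈ N.excited} {v | ∃ α : N.unknown, (σ α).2 = c ∧ α.1.1 = v}

end Network

/-!
Decoupled identifiability at `(G, G')` says that the square matrix with rows `(b, c)`, columns the
unknown edges `α = (j, i)`, and entries `T(G')_{j b} T(G)_{c i}` is invertible
(`Network.decoupledIdentifiableAt_iff`). By multilinearity in the columns its determinant is a sum
over the maps `σ_B` from unknown edges to excitations. The term of `σ_B` is, up to sign, the product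
of the entries `T(G')_{j, σ_B(α)}` times one minor of `T(G)` for each excitation `b`, with the measured
nodes as rows and the end nodes of the edges in `σ_B⁻¹(b)` as columns; it vanishes unless all these
fibres have `n_C` elements (`det_eq_sum_prod_mul_det`, `det_ne_zero_iff_of_fibers`). There is a similar
expansion over maps `σ_C` to measurements.

A minor of a transfer matrix can be nonzero only if its row and column nodes are linked by
vertex-disjoint paths (`exists_disjoint_paths_of_minor_ne_zero`), and it is generically nonzero if they
are (`exists_transfer_submatrix_eq_one`, `Network.almostAll_minor_ne_zero`). Both facts come from a
bordered determinant, which is a polynomial in the edge entries and whose nonzero Leibniz terms are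
permutations made of paths and cycles. The case of one row and one column governs the single entries.

Connectedness of an assignation through an edge splits into a path to its start node and a path from
its end node, so the path conditions split into conditions on `σ_B` alone and on `σ_C` alone
(`Network.pathConditions_iff`). If the determinant is nonzero, both expansions have a nonzero term,
and the two terms provide `σ_B` and `σ_C`. If the assignation is unique, then so is `σ_B`, since any
admissible `σ_B` can be paired with the given `σ_C`; hence the first expansion has a single term that
does not vanish identically, and no cancellation can occur.
-/

/-! ### Properties of almost all parameter vectors -/

theorem AlmostAll.exists {ι : Type*} {P : (ι → ℂ) → Prop} (h : AlmostAll P) : ∃ x, P x := by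
  obtain ⟨p, hp, h⟩ := h
  by_contra! hc
  refine hp (MvPolynomial.funext fun x => ?_)
  by_contra hx
  exact hc x (h x (by simpa using hx))

theorem AlmostAll.mono {ι : Type*} {P Q : (ι → ℂ) → Prop} (h : AlmostAll P)
    (hPQ : ∀ x, P x → Q x) : AlmostAll Q := by
  obtain ⟨p, hp, h⟩ := h
  exact ⟨p, hp, fun x hx => hPQ x (h x hx)⟩

theorem AlmostAll.and {ι : Type*} {P Q : (ι → ℂ) → Prop} (hP : AlmostAll P) (hQ : AlmostAll Q) :
    AlmostAll fun x => P x ∧ Q x := by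
  obtain ⟨p, hp, h⟩ := hP
  obtain ⟨q, hq, h'⟩ := hQ
  refine ⟨p * q, mul_ne_zero hp hq, fun x hx => ?_⟩
  rw [map_mul] at hx
  exact ⟨h x (left_ne_zero_of_mul hx), h' x (right_ne_zero_of_mul hx)⟩

theorem almostAll_forall {ι κ : Type*} [Fintype κ] {P : κ → (ι → ℂ) → Prop}
    (h : ∀ k, AlmostAll (P k)) : AlmostAll fun x => ∀ k, P k x := by
  choose p hp h using h
  refine ⟨∏ k, p k, Finset.prod_ne_zero_iff.2 fun k _ => hp k, fun x hx k => h k x ?_⟩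
  rw [map_prod] at hx
  exact Finset.prod_ne_zero_iff.1 hx k (Finset.mem_univ k)

/-- A determinant with polynomial entries that is nonzero somewhere is nonzero almost
everywhere. -/
theorem almostAll_det_ne_zero {ι n : Type*} [Fintype n] [DecidableEq n]
    {M : (ι → ℂ) → Matrix n n ℂ}
    (hM : ∀ i j, ∃ p : MvPolynomial ι ℂ, ∀ x, MvPolynomial.eval x p = M x i j)
    (h : ∃ x, (M x).det ≠ 0) : AlmostAll fun x => (M x).det ≠ 0 := by
  choose p hp using hM
  have key : ∀ x, MvPolynomial.eval x (Matrix.of p).det = (M x).det := fun x => by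
    rw [RingHom.map_det]
    congr 1
    ext i j
    simp [hp]
  obtain ⟨x₀, hx₀⟩ := h
  refine ⟨(Matrix.of p).det, fun h0 => hx₀ ?_, fun x hx => by rwa [key] at hx⟩
  rw [← key, h0, map_zero]

theorem MvPolynomial.eval_sumElim {ι κ : Type*} (x : ι → ℂ) (y : κ → ℂ)
    (p : MvPolynomial (ι ⊕ κ) ℂ) :
    MvPolynomial.eval y (MvPolynomial.map (MvPolynomial.eval x)
      (MvPolynomial.sumAlgEquiv ℂ κ ι (MvPolynomial.rename Sum.swap p))) =
        MvPolynomial.eval (Sum.elim x y) p := by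
  induction p using MvPolynomial.induction_on with
  | C a => simp
  | add p q hp hq => simp only [map_add, hp, hq]
  | mul_X p i hp =>
    simp only [map_mul, hp]
    rcases i with i | k <;> simp

/-- A Fubini principle: a property of almost all `(x, y)` holds, for almost all `x`, for almost all
`y`. -/
theorem AlmostAll.slice {ι κ : Type*} {P : (ι ⊕ κ → ℂ) → Prop} (h : AlmostAll P) :
    AlmostAll fun x : ι → ℂ => AlmostAll fun y : κ → ℂ => P (Sum.elim x y) := by
  obtain ⟨p, hp, h⟩ := h
  -- `q` is `p` as a polynomial in the variables `κ`, with coefficients polynomial in those of `ι`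
  let q := MvPolynomial.sumAlgEquiv ℂ κ ι (MvPolynomial.rename Sum.swap p)
  have hq : q ≠ 0 := by
    refine (map_ne_zero_iff _ (MvPolynomial.sumAlgEquiv ℂ κ ι).injective).2 ?_
    exact (map_ne_zero_iff _ (MvPolynomial.rename_injective _ Sum.swap_leftInverse.injective)).2 hp
  obtain ⟨d, hd⟩ := MvPolynomial.ne_zero_iff.1 hq
  refine ⟨q.coeff d, hd, fun x hx => ⟨MvPolynomial.map (MvPolynomial.eval x) q, ?_, fun y hy => ?_⟩⟩
  · exact MvPolynomial.ne_zero_iff.2 ⟨d, by rwa [MvPolynomial.coeff_map]⟩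
  · refine h _ ?_
    rwa [MvPolynomial.eval_sumElim] at hy

/-! ### Disjoint paths and minors of the transfer matrix -/

theorem IsDipath.exists_nodup {V : Type*} {D : Digraph V} {u v : V} {l : List V}
    (h : IsDipath D u v l) : ∃ l' : List V, l'.Nodup ∧ l' ⊆ l ∧ IsDipath D u v l' := by
  induction l generalizing u with
  | nil => simpa using h.head
  | cons a l ih =>
    obtain rfl : a = u := by simpa using h.head
    rcases l with - | ⟨b, l⟩
    · exact ⟨[a], by simp, by simp, h⟩
    have hc := List.isChain_cons_cons.1 h.chain
    obtain ⟨l', hn, hs, hl'⟩ := ih (u := b) ⟨hc.2, rfl, by simpa using h.last⟩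
    by_cases ha : a ∈ l'
    · -- the path returns to `a`: the detour is cut off
      obtain ⟨s, t, rfl⟩ := List.append_of_mem ha
      refine ⟨a :: t, hn.of_append_right, fun x hx => ?_, hl'.chain.right_of_append, rfl, ?_⟩
      · rcases List.mem_cons.1 hx with rfl | hx
        · simp
        · exact List.mem_cons_of_mem _ (hs (by simp [hx]))
      · simpa using hl'.last
    · refine ⟨a :: l', List.nodup_cons.2 ⟨ha, hn⟩, List.cons_subset_cons _ hs, ?_, rfl, ?_⟩
      · refine List.isChain_cons.2 ⟨fun y hy => ?_, hl'.chain⟩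
        rw [hl'.head] at hy
        obtain rfl : b = y := by simpa using hy
        exact hc.1
      · rw [List.getLast?_cons, hl'.last]; rfl

/-- A permutation of `V ⊕ ι` that moves along edges of `D` or fixes nodes, enters `V` from `m : ι` at
`s m`, and leaves `V` at the nodes `r m`, consists of node-disjoint paths (its arcs between visits to
`ι`), besides cycles that avoid `ι`. -/
theorem exists_disjoint_paths_of_perm {V ι : Type*} [Finite V] [Finite ι] (D : Digraph V)
    (s r : ι → V) (π : Equiv.Perm (V ⊕ ι)) (h₁ : ∀ m, π (.inr m) = .inl (s m))
    (h₂ : ∀ v w, π (.inl v) = .inl w → v = w ∨ D.Adj v w)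
    (h₃ : ∀ v m, π (.inl v) = .inr m → r m = v) :
    ∃ p : ι → List V, (∀ m, ∃ m', IsDipath D (s m) (r m') (p m)) ∧
      Pairwise fun m m' => List.Disjoint (p m) (p m') := by
  classical
  -- each orbit arc that starts at `inr m` eventually returns to the summand `ι`
  have hret : ∀ m, ∃ n, (π^[n + 1] (.inr m)).isRight = true := fun m => by
    refine ⟨orderOf π - 1, ?_⟩
    rw [Nat.sub_add_cancel (orderOf_pos π), ← Equiv.Perm.coe_pow, pow_orderOf_eq_one]
    rfl
  let n m := Nat.find (hret m)
  have hn : ∀ m, (π^[n m + 1] (.inr m)).isRight = true := fun m => Nat.find_spec (hret m)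
  have hlt : ∀ m i, i < n m → ∃ v, π^[i + 1] (.inr m) = .inl v := fun m i hi => by
    have := Nat.find_min (hret m) hi
    rcases hx : π^[i + 1] (.inr m) with v | k
    · exact ⟨v, rfl⟩
    · simp [hx] at this
  let f : V ⊕ ι → V := Sum.elim id r
  have hf : ∀ m i, i < n m → π^[i + 1] (.inr m) = .inl (f (π^[i + 1] (.inr m))) := by
    intro m i hi
    obtain ⟨v, hv⟩ := hlt m i hi
    rw [hv]; rfl
  have hpos : ∀ m, 0 < n m := fun m => by
    rw [Nat.pos_iff_ne_zero]
    intro h0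
    have := hn m
    simp [h0, h₁] at this
  refine ⟨fun m => (List.range (n m)).map fun i => f (π^[i + 1] (.inr m)), fun m => ?_, ?_⟩
  · have hlast : π (.inl (f (π^[n m - 1 + 1] (.inr m)))) = π^[n m + 1] (.inr m) := by
      rw [← hf m _ (Nat.sub_lt (hpos m) one_pos), Nat.sub_add_cancel (Nat.one_le_of_lt (hpos m)),
        Function.iterate_succ_apply']
    obtain ⟨m', hm'⟩ := Sum.isRight_iff.1 (hn m)
    refine ⟨m', List.isChain_iff_getElem.2 fun i hi => ?_, ?_, ?_⟩
    · simp only [List.length_map, List.length_range] at hi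
      simp only [List.getElem_map, List.getElem_range]
      have hstep : π (.inl (f (π^[i + 1] (.inr m)))) = .inl (f (π^[i + 1 + 1] (.inr m))) := by
        rw [← hf m i (by omega), ← hf m (i + 1) hi, Function.iterate_succ_apply' π (i + 1)]
      refine (h₂ _ _ hstep).resolve_left fun heq => ?_
      -- a fixed point of `π` is not on the arc of `inr m`
      rw [← heq, ← hf m i (by omega), ← Function.iterate_succ_apply' π (i + 1),
        Function.iterate_succ_apply π (i + 1)] at hstep
      have := (π.injective.iterate (i + 1)) hstep
      simp [h₁] at this
    · rw [List.head?_map, List.head?_range, if_neg (hpos m).ne']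
      simp [h₁, f]
    · rw [List.getLast?_map, List.getLast?_range, if_neg (hpos m).ne', h₃ _ m' (hlast.trans hm')]
      rfl
  · -- two arcs with a common node start at the same element of `ι`
    have key : ∀ m m' i j, i < n m → j < n m' → i ≤ j →
        f (π^[i + 1] (.inr m)) = f (π^[j + 1] (.inr m')) → m = m' := by
      intro m m' i j hi hj hij h
      have h' : π^[i + 1] (.inr m) = π^[j + 1] (.inr m') := by rw [hf m i hi, hf m' j hj, h]
      obtain ⟨d, rfl⟩ := Nat.exists_eq_add_of_le hij
      rw [show i + d + 1 = (i + 1) + d by ring, Function.iterate_add_apply π (i + 1) d] at h'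
      have h'' := π.injective.iterate (i + 1) h'
      rcases d with - | d
      · simpa using h''
      · obtain ⟨v, hv⟩ := hlt m' d (by omega)
        simp [hv] at h''
    intro m m' hne x hx hx'
    obtain ⟨i, hi, rfl⟩ := List.mem_map.1 hx
    obtain ⟨j, hj, h⟩ := List.mem_map.1 hx'
    rw [List.mem_range] at hi hj
    rcases le_total i j with hij | hij
    · exact hne (key m m' i j hi hj hij h.symm)
    · exact hne (key m' m j i hj hi hij h).symm

/-- The matrix `1 - G`, bordered by columns that select the nodes `s` and rows that select the nodes
`r`. If `1 - G` is invertible, the determinant of the bordered matrix is, up to a nonzero factor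
(Schur complement), the minor of the transfer matrix with rows `r` and columns `s`; unlike that minor
it is a polynomial in the entries of `G`. -/
def borderedMatrix {V ι : Type*} [DecidableEq V] (G : Matrix V V ℂ) (r s : ι → V) :
    Matrix (V ⊕ ι) (V ⊕ ι) ℂ :=
  Matrix.fromBlocks (1 - G) (Matrix.of fun v m => if v = s m then 1 else 0)
    (Matrix.of fun m v => if v = r m then 1 else 0) 0

theorem det_borderedMatrix_ne_zero_iff {V ι : Type*} [Fintype V] [DecidableEq V] [Fintype ι]
    [DecidableEq ι] {G : Matrix V V ℂ} (hG : Network.WellPosed G) (r s : ι → V) :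
    (borderedMatrix G r s).det ≠ 0 ↔ ((Network.transfer G).submatrix r s).det ≠ 0 := by
  have hu : IsUnit (1 - G) := hG
  have := hu.invertible
  have hsub : (Network.transfer G).submatrix r s =
      (Matrix.of fun m v => if v = r m then (1 : ℂ) else 0) * ⅟(1 - G) *
        (Matrix.of fun v m => if v = s m then (1 : ℂ) else 0) := by
    ext m m'
    simp [Network.transfer, Matrix.mul_apply, Matrix.invOf_eq_nonsing_inv]
  have hdet : (1 - G).det ≠ 0 := ((Matrix.isUnit_iff_isUnit_det _).1 hu).ne_zero
  rw [borderedMatrix, Matrix.det_fromBlocks₁₁, ← hsub, zero_sub, Matrix.det_neg]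
  simp [hdet]

/-- A nonzero term in the Leibniz expansion of the bordered determinant is a system of disjoint
paths. -/
theorem exists_disjoint_paths_of_minor_ne_zero {V ι : Type*} [Fintype V] [DecidableEq V]
    [Fintype ι] [DecidableEq ι] {D : Digraph V} {G : Matrix V V ℂ}
    (hD : ∀ i j, G i j ≠ 0 → D.Adj j i) (hG : Network.WellPosed G) (r s : ι → V)
    (h : ((Network.transfer G).submatrix r s).det ≠ 0) :
    ∃ p : ι → List V, (∀ m, ∃ m', IsDipath D (s m) (r m') (p m)) ∧
      Pairwise fun m m' => List.Disjoint (p m) (p m') := by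
  rw [← det_borderedMatrix_ne_zero_iff hG, Matrix.det_apply] at h
  obtain ⟨π, -, hπ⟩ := Finset.exists_ne_zero_of_sum_ne_zero h
  have hne : ∀ x, borderedMatrix G r s (π x) x ≠ 0 := fun x hx =>
    hπ (smul_eq_zero_of_right _ (Finset.prod_eq_zero (Finset.mem_univ x) hx))
  refine exists_disjoint_paths_of_perm D s r π (fun m => ?_) (fun v w hvw => ?_) fun v m hvm => ?_
  · have := hne (.inr m)
    rcases hx : π (.inr m) with v | k
    · rw [hx] at this
      simpa [borderedMatrix] using this
    · rw [hx] at this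
      simp [borderedMatrix] at this
  · have := hne (.inl v)
    rw [hvw] at this
    by_cases hv : v = w
    · exact .inl hv
    · refine .inr (hD w v ?_)
      simpa [borderedMatrix, Matrix.one_apply, Ne.symm hv] using this
  · have := hne (.inl v)
    rw [hvm] at this
    simp only [borderedMatrix, Matrix.fromBlocks_apply₂₁, Matrix.of_apply, ne_eq,
      ite_eq_right_iff, one_ne_zero, imp_false, not_not] at this
    exact this.symm

theorem exists_path_of_transfer_ne_zero {V : Type*} [Fintype V] [DecidableEq V]
    {D : Digraph V} {G : Matrix V V ℂ} (hD : ∀ i j, G i j ≠ 0 → D.Adj j i)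
    (hG : Network.WellPosed G) {u v : V} (h : Network.transfer G v u ≠ 0) :
    ∃ l, IsDipath D u v l := by
  obtain ⟨p, hp, -⟩ := exists_disjoint_paths_of_minor_ne_zero hD hG (fun _ : Unit => v)
    (fun _ => u) (by simpa using h)
  obtain ⟨-, hp⟩ := hp ()
  exact ⟨_, hp⟩

/-- The weights that realize disjoint paths in the transfer matrix are one on the edges of the paths,
freed from repeated nodes, and zero elsewhere. -/
theorem exists_transfer_submatrix_eq_one {V ι : Type*} [Fintype V] [DecidableEq V] [Fintype ι]
    [DecidableEq ι] {D : Digraph V} {r s : ι → V} {p : ι → List V}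
    (hp : ∀ m, IsDipath D (s m) (r m) (p m))
    (hd : Pairwise fun m m' => List.Disjoint (p m) (p m')) :
    ∃ G : Matrix V V ℂ, (∀ i j, G i j ≠ 0 → D.Adj j i) ∧ Network.WellPosed G ∧
      (Network.transfer G).submatrix r s = 1 := by
  classical
  choose q hqn hqs hq using fun m => (hp m).exists_nodup
  have hqd : ∀ {m m' x}, x ∈ q m → x ∈ q m' → m = m' := fun {m m' x} hx hx' => by
    by_contra hne
    exact hd hne (hqs _ hx) (hqs _ hx')
  -- `Next v w`: the node `w` follows `v` on one of the paths
  let Next (v w : V) : Prop := ∃ m k, ∃ h : k + 1 < (q m).length, (q m)[k] = v ∧ (q m)[k + 1] = w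
  let G : Matrix V V ℂ := Matrix.of fun w v => if Next v w then 1 else 0
  have hadj : ∀ i j, G i j ≠ 0 → D.Adj j i := fun i j hij => by
    obtain ⟨m, k, hk, rfl, rfl⟩ : Next j i := by
      by_contra hc
      exact hij (by simp [G, hc])
    exact List.isChain_iff_getElem.1 (hq m).chain k hk
  -- the position on the paths is a height function that makes `G` strictly triangular
  let ht (v : V) : ℕ := ∑ m, (q m).idxOf v
  have hht : ∀ v w, Next v w → ht v < ht w := by
    rintro _ _ ⟨m, k, hk, rfl, rfl⟩
    refine Finset.sum_lt_sum (fun m' _ => ?_) ⟨m, Finset.mem_univ m, ?_⟩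
    · by_cases hm : m = m'
      · subst hm
        rw [(hqn m).idxOf_getElem, (hqn m).idxOf_getElem]
        omega
      · rw [List.idxOf_eq_length fun h => hm (hqd (List.getElem_mem _) h),
          List.idxOf_eq_length fun h => hm (hqd (List.getElem_mem _) h)]
    · rw [(hqn m).idxOf_getElem, (hqn m).idxOf_getElem]
      omega
  have hu : IsUnit (1 - G) := by
    rw [Matrix.isUnit_iff_isUnit_det, isUnit_iff_ne_zero]
    intro hdet
    obtain ⟨y, hy0, hy⟩ := Matrix.exists_mulVec_eq_zero_iff.2 hdet
    have hy' : ∀ w, y w = ∑ v, G w v * y v := fun w => by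
      have := congrFun hy w
      rw [Matrix.sub_mulVec, Matrix.one_mulVec, Pi.sub_apply, Pi.zero_apply, sub_eq_zero] at this
      exact this
    refine hy0 (funext fun w => ?_)
    induction hw : ht w using Nat.strong_induction_on generalizing w with
    | _ n ih =>
      rw [hy' w, Pi.zero_apply]
      refine Finset.sum_eq_zero fun v _ => ?_
      by_cases hvw : Next v w
      · rw [ih (ht v) (hw ▸ hht v w hvw) v rfl, Pi.zero_apply, mul_zero]
      · simp [G, hvw]
  refine ⟨G, hadj, hu, ?_⟩
  -- the response to an input at `s m` is the indicator function of the path `q m`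
  have hsol : ∀ m, (1 - G).mulVec (fun v => if v ∈ q m then 1 else 0) = Pi.single (s m) 1 := by
    intro m
    ext w
    rw [Matrix.sub_mulVec, Matrix.one_mulVec, Pi.sub_apply]
    have hhead : ∃ h : 0 < (q m).length, (q m)[0] = s m := by
      have := (hq m).head
      rw [List.head?_eq_getElem?] at this
      exact List.getElem?_eq_some_iff.1 this
    obtain ⟨h0, hs0⟩ := hhead
    have hG0 : ∀ v, v ∈ q m → ¬ Next v w → G w v = 0 := fun v _ h => by simp [G, h]
    by_cases hw : w ∈ q m
    · obtain ⟨k, hk, rfl⟩ := List.mem_iff_getElem.1 hw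
      rcases k with - | k
      · have : G.mulVec (fun v => if v ∈ q m then (1 : ℂ) else 0) (q m)[0] = 0 := by
          refine Finset.sum_eq_zero fun v _ => ?_
          have : ¬ Next v (q m)[0] := by
            rintro ⟨m', k, hk', -, h⟩
            obtain rfl : m' = m := hqd (List.getElem_mem hk') (h ▸ List.getElem_mem _)
            have := (hqn m').getElem_inj_iff.1 h
            omega
          simp [G, this]
        rw [this, hs0]
        simp [← hs0]
      · have : G.mulVec (fun v => if v ∈ q m then (1 : ℂ) else 0) (q m)[k + 1] = 1 := by
          refine (Finset.sum_eq_single (q m)[k] (fun v _ hv => ?_) (by simp)).trans ?_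
          · have : ¬ Next v (q m)[k + 1] := by
              rintro ⟨m', k', hk', rfl, h⟩
              obtain rfl : m' = m := hqd (List.getElem_mem hk') (h ▸ List.getElem_mem _)
              have := (hqn m').getElem_inj_iff.1 h
              exact hv (by congr 1; omega)
            simp [G, this]
          · have : Next (q m)[k] (q m)[k + 1] := ⟨m, k, hk, rfl, rfl⟩
            simp [G, this]
        have hne : (q m)[k + 1] ≠ s m := by
          rw [← hs0]
          intro h
          have := (hqn m).getElem_inj_iff.1 h
          omega
        rw [this]
        simp [hne]
    · have : G.mulVec (fun v => if v ∈ q m then (1 : ℂ) else 0) w = 0 := by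
        refine Finset.sum_eq_zero fun v _ => ?_
        by_cases hv : v ∈ q m
        · have : ¬ Next v w := by
            rintro ⟨m', k, hk, rfl, rfl⟩
            obtain rfl : m' = m := hqd (List.getElem_mem _) hv
            exact hw (List.getElem_mem _)
          simp [G, this]
        · simp [hv]
      have hne : w ≠ s m := by
        rintro rfl
        exact hw (hs0 ▸ List.getElem_mem _)
      rw [this]
      simp [hw, hne]
  have hdet := (Matrix.isUnit_iff_isUnit_det _).1 hu
  ext m' m
  have hcol : (fun v => if v ∈ q m then (1 : ℂ) else 0) =
      (Network.transfer G).mulVec (Pi.single (s m) 1) := by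
    rw [← hsol, Matrix.mulVec_mulVec, Network.transfer, Matrix.nonsing_inv_mul _ hdet,
      Matrix.one_mulVec]
  have hent := congrFun hcol (r m')
  rw [Matrix.mulVec_single_one] at hent
  have hr : r m' ∈ q m' := List.mem_of_getLast? (hq m').last
  rw [Matrix.one_apply]
  refine Eq.trans hent.symm ?_
  refine if_congr ⟨fun h => hqd hr h, fun h => h ▸ hr⟩ rfl rfl

/-! ### Determinants of columnwise Khatri–Rao products -/

/-- Expansion by multilinearity in the columns: column `α` is the sum over `b` of its restrictions to
the rows with first index `b`, and the expansion chooses one such `b = σ α` for each column. -/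
theorem det_eq_sum_prod_mul_det {F E B C : Type*} [Field F] [Fintype E] [DecidableEq E]
    [Fintype B] [DecidableEq B] (e : E → B × C) (P : E → B → F) (Q : E → C → F) :
    (Matrix.of fun α' α => P α (e α').1 * Q α (e α').2).det =
      ∑ σ : E → B, (∏ α, P α (σ α)) *
        (Matrix.of fun α' α => if (e α').1 = σ α then Q α (e α').2 else 0).det := by
  let col (σ : B) (α : E) : E → F := fun α' => if (e α').1 = σ then Q α (e α').2 else 0
  have h := (Matrix.detRowAlternating (R := F) (n := E)).toMultilinearMap.map_sum
    (fun (α : E) (b : B) => P α b • col b α)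
  rw [← Matrix.det_transpose]
  convert h using 1
  · change Matrix.det _ = Matrix.det _
    congr 1
    ext α α'
    simp [col, Finset.sum_apply]
  · refine Finset.sum_congr rfl fun σ _ => ?_
    rw [MultilinearMap.map_smul_univ, smul_eq_mul, ← Matrix.det_transpose]
    rfl

/-- When `σ α = (π α).1` for a bijection `π`, the matrices in the expansion are block diagonal up to
reindexing. -/
theorem det_ne_zero_iff_of_fibers {F E B C : Type*} [Field F] [Fintype E] [DecidableEq E]
    [Fintype B] [DecidableEq B] [Fintype C] [DecidableEq C] (e π : E ≃ B × C)
    (Q : E → C → F) :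
    (Matrix.of fun α' α => if (e α').1 = (π α).1 then Q α (e α').2 else 0).det ≠ 0 ↔
      ∀ b, (Matrix.of fun c c' => Q (π.symm (b, c')) c).det ≠ 0 := by
  have h : (Matrix.of fun α' α => if (e α').1 = (π α).1 then Q α (e α').2 else 0) =
      (Matrix.blockDiagonal fun b => Matrix.of fun c c' => Q (π.symm (b, c')) c).submatrix
        (e.trans (Equiv.prodComm B C)) (π.trans (Equiv.prodComm B C)) := by
    ext α' α
    by_cases hb : (e α').1 = (π α).1
    · simp [Matrix.blockDiagonal_apply, hb]
    · simp [Matrix.blockDiagonal_apply, hb]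
  rw [h, ← isUnit_iff_ne_zero, ← Matrix.isUnit_iff_isUnit_det, Matrix.isUnit_submatrix_equiv,
    Matrix.isUnit_iff_isUnit_det, Matrix.det_blockDiagonal, isUnit_iff_ne_zero,
    Finset.prod_ne_zero_iff]
  simp

/-- A term of the expansion vanishes unless all fibres of `σ` have the size of `C`. -/
theorem exists_equiv_of_det_ne_zero {F E B C : Type*} [Field F] [Fintype E] [DecidableEq E]
    [DecidableEq B] (e : E ≃ B × C) (σ : E → B) (Q : E → C → F)
    (h : (Matrix.of fun α' α => if (e α').1 = σ α then Q α (e α').2 else 0).det ≠ 0) :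
    ∃ π : E ≃ B × C, ∀ α, (π α).1 = σ α := by
  rw [Matrix.det_apply] at h
  obtain ⟨τ, -, hτ⟩ := Finset.exists_ne_zero_of_sum_ne_zero h
  refine ⟨τ.trans e, fun α => ?_⟩
  by_contra hα
  refine hτ ?_
  rw [Finset.prod_eq_zero (Finset.mem_univ α), smul_zero]
  simpa using fun h' => absurd h' hα

theorem exists_equiv_of_card_fiber {E B C : Type*} [Fintype E]
    [DecidableEq B] [Fintype C] (σ : E → B)
    (h : ∀ b, Fintype.card {α // σ α = b} = Fintype.card C) :
    ∃ π : E ≃ B × C, ∀ α, (π α).1 = σ α :=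
  ⟨(Equiv.sigmaFiberEquiv σ).symm.trans ((Equiv.sigmaCongrRight fun b =>
    Fintype.equivOfCardEq (h b)).trans (Equiv.sigmaEquivProd B C)), fun _ => rfl⟩

theorem card_fiber_of_equiv {E B C : Type*} [Fintype E]
    [DecidableEq B] [Fintype C] {σ : E → B} (π : E ≃ B × C) (h : ∀ α, (π α).1 = σ α) (b : B) :
    Fintype.card {α // σ α = b} = Fintype.card C := by
  refine Fintype.card_congr ⟨fun α => (π α).2, fun c => ⟨π.symm (b, c), by simp [← h]⟩, ?_, ?_⟩
  · rintro ⟨α, rfl⟩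
    simp [← h]
  · intro c
    simp

/-! ### Splitting the path conditions -/

namespace Network

variable {V : Type*} [DecidableEq V]

/-- The conditions that `PathConditions` imposes on the first component `σ_B` of an assignation.
Connectedness of an edge splits into a path to its start node, required here, and a path from its
end node. -/
structure AdmissibleExcitation (N : Network V) (σ : N.unknown → N.excited) : Prop where
  card : ∀ b, Fintype.card {α // σ α = b} = N.measured.card
  path : ∀ α, ∃ l, IsDipath N.graph (σ α) α.1.1 l
  disjoint_paths : ∀ b : N.excited, HasVertexDisjointPaths N.graph N.measured.card
    {v | ∃ α : N.unknown, σ α = b ∧ α.1.2 = v} {v | v ∈ N.measured}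

/-- The conditions that `PathConditions` imposes on the second component `σ_C` of an
assignation. -/
structure AdmissibleMeasurement (N : Network V) (σ : N.unknown → N.measured) : Prop where
  card : ∀ c, Fintype.card {α // σ α = c} = N.excited.card
  path : ∀ α, ∃ l, IsDipath N.graph α.1.2 (σ α) l
  disjoint_paths : ∀ c : N.measured, HasVertexDisjointPaths N.graph N.excited.card
    {v | v ∈ N.excited} {v | ∃ α : N.unknown, σ α = c ∧ α.1.1 = v}

theorem connectedThrough_iff {V : Type*} {D : Digraph V} {e : V × V} (he : D.Adj e.1 e.2)
    {u v : V} : ConnectedThrough D u e v ↔ (∃ l, IsDipath D u e.1 l) ∧ ∃ l, IsDipath D e.2 v l := by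
  constructor
  · rintro ⟨l₁, l₂, h₁, h₂, h⟩
    have hne₁ : l₁ ≠ [] := by rintro rfl; simp at h₁
    have hne₂ : l₂ ≠ [] := by rintro rfl; simp at h₂
    refine ⟨⟨l₁, h.chain.left_of_append, ?_, h₁⟩, ⟨l₂, h.chain.right_of_append, h₂, ?_⟩⟩
    · rw [← h.head, List.head?_append_of_ne_nil _ hne₁]
    · rw [← h.last, List.getLast?_append_of_ne_nil _ hne₂]
  · rintro ⟨⟨l₁, h₁⟩, ⟨l₂, h₂⟩⟩
    have hne₁ : l₁ ≠ [] := by rintro rfl; simpa using h₁.head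
    have hne₂ : l₂ ≠ [] := by rintro rfl; simpa using h₂.head
    refine ⟨l₁, l₂, h₁.last, h₂.head, List.isChain_append.2 ⟨h₁.chain, h₂.chain, ?_⟩, ?_, ?_⟩
    · intro x hx y hy
      rw [h₁.last, Option.mem_some_iff] at hx
      rw [h₂.head, Option.mem_some_iff] at hy
      rwa [← hx, ← hy]
    · rw [List.head?_append_of_ne_nil _ hne₁, h₁.head]
    · rw [List.getLast?_append_of_ne_nil _ hne₂, h₂.last]

theorem pathConditions_iff {N : Network V} {σ : N.unknown → N.excited × N.measured} :
    N.PathConditions σ ↔ N.AdmissibleExcitation (fun α => (σ α).1) ∧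
      N.AdmissibleMeasurement (fun α => (σ α).2) := by
  have hconn : ∀ α, ConnectedThrough N.graph (σ α).1 α (σ α).2 ↔ _ := fun α =>
    connectedThrough_iff (D := N.graph) (e := α.1) (.inr α.2)
  constructor
  · intro h
    exact ⟨⟨h.card_excitation, fun α => ((hconn α).1 (h.connected α)).1, h.paths_to_measured⟩,
      ⟨h.card_measurement, fun α => ((hconn α).1 (h.connected α)).2, h.paths_from_excited⟩⟩
  · rintro ⟨hB, hC⟩
    exact ⟨hB.card, hC.card, fun α => (hconn α).2 ⟨hB.path α, hC.path α⟩, hB.disjoint_paths,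
      hC.disjoint_paths⟩

theorem networkMatrix_ne_zero (N : Network V) (g : N.known → ℂ) (x : N.unknown → ℂ) (i j : V)
    (h : N.networkMatrix g x i j ≠ 0) : N.graph.Adj j i := by
  by_contra hc
  have hc' : (j, i) ∉ N.known ∧ (j, i) ∉ N.unknown := not_or.1 hc
  exact h (by simp [networkMatrix, edgeMatrix, hc'.1, hc'.2])

theorem networkMatrix_eq (N : Network V) {G : Matrix V V ℂ}
    (hG : ∀ i j, G i j ≠ 0 → N.graph.Adj j i) :
    N.networkMatrix (fun e => G e.1.2 e.1.1) (fun e => G e.1.2 e.1.1) = G := by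
  ext i j
  by_cases h : (j, i) ∈ N.known
  · simp [networkMatrix, edgeMatrix, h, Finset.disjoint_left.1 N.disjoint h]
  · by_cases h' : (j, i) ∈ N.unknown
    · simp [networkMatrix, edgeMatrix, h, h']
    · have : G i j = 0 := by
        by_contra hc
        exact (hG i j hc).elim h h'
      simp [networkMatrix, edgeMatrix, h, h', this]

/-! ### The identifiability matrix -/

theorem measurement_mul_mul_excitation_apply [Fintype V] (N : Network V) {T T' Δ : Matrix V V ℂ}
    (hΔ : ∀ i j, (j, i) ∉ N.unknown → Δ i j = 0) (c : N.measured) (b : N.excited) :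
    (N.measurementMatrix * T * Δ * T' * N.excitationMatrix) c b =
      ∑ α : N.unknown, T' α.1.1 b * T c α.1.2 * Δ α.1.2 α.1.1 := by
  have h : (N.measurementMatrix * T * Δ * T' * N.excitationMatrix) c b =
      ∑ e : V × V, T' e.1 b * T c e.2 * Δ e.2 e.1 := by
    simp only [measurementMatrix, excitationMatrix, Matrix.mul_apply, Matrix.of_apply,
      ite_mul, one_mul, zero_mul, mul_ite, mul_one, mul_zero, Finset.sum_ite_eq',
      Finset.mem_univ, if_true, Fintype.sum_prod_type, Finset.sum_mul]
    refine Finset.sum_congr rfl fun j _ => Finset.sum_congr rfl fun i _ => ?_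
    ring
  rw [h, ← Finset.sum_subset (Finset.subset_univ N.unknown), ← Finset.sum_coe_sort]
  intro e _ he
  rw [hΔ _ _ he, mul_zero]

/-- Decoupled identifiability is injectivity of a linear map from `Δ` to the pairs (excitation,
measurement); the rows of its matrix are indexed by the unknown edges through `e`. -/
theorem decoupledIdentifiableAt_iff [Fintype V] (N : Network V)
    (e : N.unknown ≃ N.excited × N.measured) (G G' : Matrix V V ℂ) :
    N.DecoupledIdentifiableAt G G' ↔ (Matrix.of fun α' α : N.unknown =>
      transfer G' α.1.1 (e α').1 * transfer G (e α').2 α.1.2).det ≠ 0 := by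
  rw [ne_eq, ← Matrix.exists_mulVec_eq_zero_iff, not_exists]
  constructor
  · rintro h δ ⟨hδ0, hδ⟩
    have hsupp : ∀ i j, (j, i) ∉ N.unknown → edgeMatrix N.unknown δ i j = 0 := fun i j hij => by
      simp [edgeMatrix, hij]
    have hval : ∀ α : N.unknown, edgeMatrix N.unknown δ α.1.2 α.1.1 = δ α := fun α => by
      simp [edgeMatrix]
    refine hδ0 (funext fun α => ?_)
    rw [← hval, h _ hsupp]
    · rfl
    ext c b
    rw [N.measurement_mul_mul_excitation_apply hsupp]
    have := congrFun hδ (e.symm (b, c))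
    simpa [Matrix.mulVec, dotProduct, hval] using this
  · intro h Δ hΔ h0
    have hzero : (fun α : N.unknown => Δ α.1.2 α.1.1) = 0 := by
      by_contra hne
      refine h _ ⟨hne, funext fun α' => ?_⟩
      have := congrFun (congrFun h0 (e α').2) (e α').1
      rw [N.measurement_mul_mul_excitation_apply hΔ] at this
      exact this
    ext i j
    by_cases hij : (j, i) ∈ N.unknown
    · exact congrFun hzero ⟨(j, i), hij⟩
    · exact hΔ i j hij

/-- A map `σ` whose term in the expansion along the excitations is nonzero is admissible. -/
theorem admissibleExcitation_of_ne_zero [Fintype V] (N : Network V)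
    (e : N.unknown ≃ N.excited × N.measured) {G G' : Matrix V V ℂ}
    (hG : WellPosed G) (hG' : WellPosed G') (hD : ∀ i j, G i j ≠ 0 → N.graph.Adj j i)
    (hD' : ∀ i j, G' i j ≠ 0 → N.graph.Adj j i) {σ : N.unknown → N.excited}
    (hprod : ∏ α : N.unknown, transfer G' α.1.1 (σ α) ≠ 0)
    (hdet : (Matrix.of fun α' α : N.unknown =>
      if (e α').1 = σ α then transfer G (e α').2 α.1.2 else 0).det ≠ 0) :
    N.AdmissibleExcitation σ := by
  obtain ⟨π, hπ⟩ := exists_equiv_of_det_ne_zero e σ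
    (fun α c => transfer G c α.1.2) hdet
  refine ⟨fun b => by rw [card_fiber_of_equiv π hπ b, Fintype.card_coe], fun α => ?_, fun b => ?_⟩
  · exact exists_path_of_transfer_ne_zero hD' hG'
      (Finset.prod_ne_zero_iff.1 hprod α (Finset.mem_univ α))
  · simp only [← hπ] at hdet
    have hb := (det_ne_zero_iff_of_fibers e π (fun α c => transfer G c α.1.2)).1 hdet b
    obtain ⟨p, hp, hpd⟩ := exists_disjoint_paths_of_minor_ne_zero hD hG
      (fun c : N.measured => (c : V)) (fun c => (π.symm (b, c)).1.2) hb
    let f : Fin N.measured.card ≃ N.measured := N.measured.equivFin.symm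
    refine ⟨fun m => p (f m), fun m => ?_, fun m m' h => hpd (f.injective.ne h)⟩
    obtain ⟨c', hc'⟩ := hp (f m)
    exact ⟨_, ⟨π.symm (b, f m), by simp [← hπ], rfl⟩, _, c'.2, hc'⟩

/-- A map `σ` whose term in the expansion along the measurements is nonzero is admissible. -/
theorem admissibleMeasurement_of_ne_zero [Fintype V] (N : Network V)
    (e : N.unknown ≃ N.measured × N.excited) {G G' : Matrix V V ℂ}
    (hG : WellPosed G) (hG' : WellPosed G') (hD : ∀ i j, G i j ≠ 0 → N.graph.Adj j i)
    (hD' : ∀ i j, G' i j ≠ 0 → N.graph.Adj j i) {σ : N.unknown → N.measured}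
    (hprod : ∏ α : N.unknown, transfer G (σ α) α.1.2 ≠ 0)
    (hdet : (Matrix.of fun α' α : N.unknown =>
      if (e α').1 = σ α then transfer G' α.1.1 (e α').2 else 0).det ≠ 0) :
    N.AdmissibleMeasurement σ := by
  obtain ⟨π, hπ⟩ := exists_equiv_of_det_ne_zero e σ
    (fun α b => transfer G' α.1.1 b) hdet
  refine ⟨fun b => by rw [card_fiber_of_equiv π hπ b, Fintype.card_coe], fun α => ?_, fun c => ?_⟩
  · exact exists_path_of_transfer_ne_zero hD hG
      (Finset.prod_ne_zero_iff.1 hprod α (Finset.mem_univ α))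
  · simp only [← hπ] at hdet
    have hc := (det_ne_zero_iff_of_fibers e π (fun α b => transfer G' α.1.1 b)).1 hdet c
    rw [← Matrix.det_transpose] at hc
    obtain ⟨p, hp, hpd⟩ := exists_disjoint_paths_of_minor_ne_zero hD' hG'
      (fun b : N.excited => (π.symm (c, b)).1.1) (fun b => (b : V)) hc
    let f : Fin N.excited.card ≃ N.excited := N.excited.equivFin.symm
    refine ⟨fun m => p (f m), fun m => ?_, fun m m' h => hpd (f.injective.ne h)⟩
    obtain ⟨b', hb'⟩ := hp (f m)
    exact ⟨_, (f m).2, _, ⟨π.symm (c, b'), by simp [← hπ], rfl⟩, hb'⟩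

/-- Expanding the determinant along the excitations gives `σ_B`, along the measurements `σ_C`;
together they form an assignation. -/
theorem exists_pathConditions [Fintype V] (N : Network V)
    (e : N.unknown ≃ N.excited × N.measured) {G G' : Matrix V V ℂ}
    (hG : WellPosed G) (hG' : WellPosed G') (hD : ∀ i j, G i j ≠ 0 → N.graph.Adj j i)
    (hD' : ∀ i j, G' i j ≠ 0 → N.graph.Adj j i) (h : N.DecoupledIdentifiableAt G G') :
    ∃ σ, N.PathConditions σ := by
  rw [N.decoupledIdentifiableAt_iff e] at h
  have hB := h
  rw [det_eq_sum_prod_mul_det e (fun (α : N.unknown) (b : N.excited) => transfer G' α.1.1 b)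
    (fun α (c : N.measured) => transfer G c α.1.2)] at hB
  obtain ⟨σB, -, hσB⟩ := Finset.exists_ne_zero_of_sum_ne_zero hB
  let e' := e.trans (Equiv.prodComm _ _)
  have hC : (Matrix.of fun α' α : N.unknown =>
      transfer G (e' α').1 α.1.2 * transfer G' α.1.1 (e' α').2).det ≠ 0 := by
    simpa only [mul_comm] using! h
  rw [det_eq_sum_prod_mul_det e'
    (fun (α : N.unknown) (c : N.measured) => transfer G c α.1.2)
    (fun α (b : N.excited) => transfer G' α.1.1 b)] at hC
  obtain ⟨σC, -, hσC⟩ := Finset.exists_ne_zero_of_sum_ne_zero hC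
  exact ⟨fun α => (σB α, σC α), pathConditions_iff.2
    ⟨N.admissibleExcitation_of_ne_zero e hG hG' hD hD' (left_ne_zero_of_mul hσB)
      (right_ne_zero_of_mul hσB),
    N.admissibleMeasurement_of_ne_zero _ hG hG' hD hD' (left_ne_zero_of_mul hσC)
      (right_ne_zero_of_mul hσC)⟩⟩

/-! ### Generic nonvanishing -/

/-- The maps `a` and `b` name the coordinates of a parameter vector `w` that serve as known and
unknown entries. -/
theorem networkMatrix_polynomial {κ : Type*} (N : Network V) (a : N.known → κ) (b : N.unknown → κ)
    (i j : V) : ∃ p : MvPolynomial κ ℂ, ∀ w : κ → ℂ,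
      MvPolynomial.eval w p = N.networkMatrix (w ∘ a) (w ∘ b) i j := by
  refine ⟨(if h : (j, i) ∈ N.known then .X (a ⟨(j, i), h⟩) else 0 :
      MvPolynomial κ ℂ) +
    (if h : (j, i) ∈ N.unknown then .X (b ⟨(j, i), h⟩) else 0 : MvPolynomial κ ℂ), fun w => ?_⟩
  rw [map_add, networkMatrix, Matrix.add_apply]
  congr 1
  all_goals
    simp only [edgeMatrix, Matrix.of_apply]
    split_ifs <;> simp

theorem one_sub_networkMatrix_polynomial {κ : Type*} (N : Network V) (a : N.known → κ)
    (b : N.unknown → κ) (i j : V) :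
    ∃ p : MvPolynomial κ ℂ, ∀ w : κ → ℂ,
      MvPolynomial.eval w p = (1 - N.networkMatrix (w ∘ a) (w ∘ b)) i j := by
  obtain ⟨p, hp⟩ := N.networkMatrix_polynomial a b i j
  exact ⟨.C ((1 : Matrix V V ℂ) i j) - p, fun w => by simp [hp]⟩

section Generic

variable [Fintype V] {κ : Type*} (N : Network V) {a : N.known → κ} {b : N.unknown → κ}

theorem almostAll_wellPosed (a : N.known → κ) (b : N.unknown → κ) :
    AlmostAll fun w : κ → ℂ => WellPosed (N.networkMatrix (w ∘ a) (w ∘ b)) := by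
  refine (almostAll_det_ne_zero (N.one_sub_networkMatrix_polynomial a b) ⟨0, ?_⟩).mono fun w hw =>
    (Matrix.isUnit_iff_isUnit_det _).2 (isUnit_iff_ne_zero.2 hw)
  have : N.networkMatrix ((0 : κ → ℂ) ∘ a) ((0 : κ → ℂ) ∘ b) = 0 := by
    ext i j
    simp [networkMatrix, edgeMatrix]
  rw [this]
  simp

/-- A minor of the transfer matrix that is nonzero for some weights on the edges of the network is
generically nonzero. The entries are drawn from a larger vector `w`, so that two network matrices
can share their known entries. -/
theorem almostAll_minor_ne_zero {ι : Type*} [Fintype ι] [DecidableEq ι] (r s : ι → V)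
    (hab : Function.Injective (Sum.elim a b))
    (h : ∃ G : Matrix V V ℂ, (∀ i j, G i j ≠ 0 → N.graph.Adj j i) ∧ WellPosed G ∧
      ((transfer G).submatrix r s).det ≠ 0) :
    AlmostAll fun w : κ → ℂ =>
      ((transfer (N.networkMatrix (w ∘ a) (w ∘ b))).submatrix r s).det ≠ 0 := by
  have hdet : AlmostAll fun w : κ → ℂ =>
      (borderedMatrix (N.networkMatrix (w ∘ a) (w ∘ b)) r s).det ≠ 0 := by
    refine almostAll_det_ne_zero (fun x y => ?_) ?_
    · rcases x with x | x <;> rcases y with y | y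
      · exact N.one_sub_networkMatrix_polynomial a b x y
      · exact ⟨.C (if x = s y then 1 else 0), fun w => MvPolynomial.eval_C _⟩
      · exact ⟨.C (if y = r x then 1 else 0), fun w => MvPolynomial.eval_C _⟩
      · exact ⟨0, fun w => by simp [borderedMatrix]⟩
    · obtain ⟨G, hD, hG, hne⟩ := h
      let z : N.known ⊕ N.unknown → ℂ :=
        Sum.elim (fun e => G e.1.2 e.1.1) (fun e => G e.1.2 e.1.1)
      have hz : ∀ t, Function.extend (Sum.elim a b) z 0 (Sum.elim a b t) = z t :=
        fun t => hab.extend_apply z 0 t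
      -- the weights `G`, extended by zero to the parameters that `a` and `b` do not use
      refine ⟨Function.extend (Sum.elim a b) z 0, ?_⟩
      have hza : Function.extend (Sum.elim a b) z 0 ∘ a = fun e => G e.1.2 e.1.1 :=
        funext fun e => hz (.inl e)
      have hzb : Function.extend (Sum.elim a b) z 0 ∘ b = fun e => G e.1.2 e.1.1 :=
        funext fun e => hz (.inr e)
      rw [hza, hzb, N.networkMatrix_eq hD]
      exact (det_borderedMatrix_ne_zero_iff hG r s).2 hne
  exact (hdet.and (N.almostAll_wellPosed a b)).mono fun w hw =>
    (det_borderedMatrix_ne_zero_iff hw.2 r s).1 hw.1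

theorem almostAll_transfer_ne_zero (hab : Function.Injective (Sum.elim a b)) {u v : V}
    (h : ∃ l, IsDipath N.graph u v l) :
    AlmostAll fun w : κ → ℂ => transfer (N.networkMatrix (w ∘ a) (w ∘ b)) v u ≠ 0 := by
  obtain ⟨l, hl⟩ := h
  obtain ⟨G, hD, hG, h1⟩ := exists_transfer_submatrix_eq_one (ι := Unit) (s := fun _ => u)
    (r := fun _ => v) (p := fun _ => l) (fun _ => hl) (fun _ _ h => (h rfl).elim)
  have h := N.almostAll_minor_ne_zero (fun _ : Unit => v) (fun _ => u) hab
    ⟨G, hD, hG, by rw [h1]; simp⟩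
  simpa using h

/-- The minors in the term of an admissible `σ` can each be made nonzero: by counting, the disjoint
paths of `b` use every edge assigned to `b` and every measured node. -/
theorem AdmissibleExcitation.exists_minor_ne_zero {σ : N.unknown → N.excited}
    (h : N.AdmissibleExcitation σ) {π : N.unknown ≃ N.excited × N.measured}
    (hπ : ∀ α, (π α).1 = σ α) (b : N.excited) :
    ∃ G : Matrix V V ℂ, (∀ i j, G i j ≠ 0 → N.graph.Adj j i) ∧ WellPosed G ∧
      ((transfer G).submatrix (fun c : N.measured => (c : V))
        fun c => (π.symm (b, c)).1.2).det ≠ 0 := by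
  obtain ⟨p, hp, hpd⟩ := h.disjoint_paths b
  choose u hu v hv hp using hp
  choose α hα hαu using hu
  obtain ⟨G, hD, hG, h1⟩ := exists_transfer_submatrix_eq_one hp hpd
  refine ⟨G, hD, hG, ?_⟩
  -- disjoint paths have different end nodes, and leave different edges
  have hinj_v : Function.Injective v := fun m m' hm => by
    by_contra hne
    exact hpd hne (List.mem_of_getLast? (hp m).last) (hm ▸ List.mem_of_getLast? (hp m').last)
  have hinj_u : Function.Injective u := fun m m' hm => by
    by_contra hne
    exact hpd hne (List.mem_of_head? (hp m).head) (hm ▸ List.mem_of_head? (hp m').head)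
  have hbij : ∀ f : Fin N.measured.card → N.measured, Function.Injective f →
      Function.Bijective f := fun f hf =>
    (Fintype.bijective_iff_injective_and_card f).2 ⟨hf, by simp⟩
  let f := Equiv.ofBijective _ (hbij (fun m => ⟨v m, hv m⟩) fun m m' hm =>
    hinj_v (congrArg Subtype.val hm))
  let k := Equiv.ofBijective _ (hbij (fun m => (π (α m)).2) fun m m' hm => by
    have hαα : α m = α m' := π.injective (Prod.ext (by rw [hπ, hπ, hα, hα]) hm)
    exact hinj_u (by rw [← hαu, ← hαu, hαα]))
  have hk : ∀ m, π.symm (b, k m) = α m := fun m => by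
    rw [Equiv.symm_apply_eq]
    exact Prod.ext (by rw [hπ, hα]) rfl
  have hsub : ((transfer G).submatrix (fun c : N.measured => (c : V))
      fun c => (π.symm (b, c)).1.2).submatrix f k = 1 := by
    rw [← h1, Matrix.submatrix_submatrix]
    congr 1
    exact funext fun m => by simp [hk, hαu]
  rw [← isUnit_iff_ne_zero, ← Matrix.isUnit_iff_isUnit_det, ← Matrix.isUnit_submatrix_equiv f k,
    hsub]
  exact isUnit_one

/-- If only one choice of `σ_B` is admissible, the determinant of the identifiability matrix has
a single nonzero term. -/
theorem almostAll_of_unique (e : N.unknown ≃ N.excited × N.measured)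
    {σ : N.unknown → N.excited} (hσ : N.AdmissibleExcitation σ)
    (huniq : ∀ σ', N.AdmissibleExcitation σ' → σ' = σ) :
    AlmostAll fun w : N.known ⊕ (N.unknown ⊕ N.unknown) → ℂ =>
      let G := N.networkMatrix (w ∘ .inl) (w ∘ (.inr ∘ .inl))
      let G' := N.networkMatrix (w ∘ .inl) (w ∘ (.inr ∘ .inr))
      WellPosed G ∧ WellPosed G' ∧ N.DecoupledIdentifiableAt G G' := by
  obtain ⟨π, hπ⟩ := exists_equiv_of_card_fiber (C := N.measured) σ fun b => by
    rw [hσ.card, Fintype.card_coe]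
  have hinj : Function.Injective (Sum.elim (.inl : N.known → N.known ⊕ (N.unknown ⊕ N.unknown))
      (.inr ∘ .inl)) := by
    rintro (x | x) (y | y) <;> simp
  have hinj' : Function.Injective (Sum.elim (.inl : N.known → N.known ⊕ (N.unknown ⊕ N.unknown))
      (.inr ∘ .inr)) := by
    rintro (x | x) (y | y) <;> simp
  refine AlmostAll.mono ((N.almostAll_wellPosed .inl (.inr ∘ .inl)).and
    ((N.almostAll_wellPosed .inl (.inr ∘ .inr)).and
    ((almostAll_forall fun α => N.almostAll_transfer_ne_zero hinj' (hσ.path α)).and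
    (almostAll_forall fun b => N.almostAll_minor_ne_zero _ _ hinj
      (hσ.exists_minor_ne_zero N hπ b))))) ?_
  rintro w ⟨hG, hG', hT, hM⟩
  refine ⟨hG, hG', ?_⟩
  have hD := N.networkMatrix_ne_zero (w ∘ .inl) (w ∘ (.inr ∘ .inl))
  have hD' := N.networkMatrix_ne_zero (w ∘ .inl) (w ∘ (.inr ∘ .inr))
  generalize N.networkMatrix (w ∘ .inl) (w ∘ (.inr ∘ .inl)) = G at *
  generalize N.networkMatrix (w ∘ .inl) (w ∘ (.inr ∘ .inr)) = G' at *
  rw [N.decoupledIdentifiableAt_iff e,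
    det_eq_sum_prod_mul_det e (fun (α : N.unknown) (b : N.excited) => transfer G' α.1.1 b)
      (fun α (c : N.measured) => transfer G c α.1.2), Finset.sum_eq_single σ]
  · refine mul_ne_zero (Finset.prod_ne_zero_iff.2 fun α _ => hT α) ?_
    simp only [← hπ]
    exact (det_ne_zero_iff_of_fibers e π (fun α (c : N.measured) => transfer G c α.1.2)).2 hM
  · intro σ' _ hne
    by_contra h0
    exact hne (huniq σ' (N.admissibleExcitation_of_ne_zero e hG hG' hD hD'
      (left_ne_zero_of_mul h0) (right_ne_zero_of_mul h0)))
  · simp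

end Generic

end Network

theorem theorem1 {V : Type*} [Fintype V] [DecidableEq V] (N : Network V)
    (hcard : N.unknown.card = N.excited.card * N.measured.card) :
    (∀ g : N.known → ℂ, N.GenericallyDecoupledIdentifiable g →
      ∃ σ : N.unknown → N.excited × N.measured, N.PathConditions σ) ∧
    ((∃! σ : N.unknown → N.excited × N.measured, N.PathConditions σ) →
      AlmostAll fun g : N.known → ℂ => N.GenericallyDecoupledIdentifiable g) := by
  have e : N.unknown ≃ N.excited × N.measured := Fintype.equivOfCardEq (by simp [hcard])
  constructor
  · intro g hg
    obtain ⟨z, hG, hG', hz⟩ := AlmostAll.exists hg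
    exact N.exists_pathConditions e hG hG' (N.networkMatrix_ne_zero _ _)
      (N.networkMatrix_ne_zero _ _) hz
  · rintro ⟨σ, hσ, huniq⟩
    obtain ⟨hB, hC⟩ := Network.pathConditions_iff.1 hσ
    -- an admissible `σ_B` can be paired with any admissible `σ_C`
    have hBuniq : ∀ σ', N.AdmissibleExcitation σ' → σ' = fun α => (σ α).1 := fun σ' hσ' => by
      have := huniq (fun α => (σ' α, (σ α).2)) (Network.pathConditions_iff.2 ⟨hσ', hC⟩)
      exact funext fun α => congrArg Prod.fst (congrFun this α)
    exact (N.almostAll_of_unique e hB hBuniq).slice
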